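/- Define integers $h_1(n)$ for $n\ge 0$ by $$\sum_{n=0}^{\infty}h_1(n)q^n=(-q^2,-q^3;q^5)_\infty^2\,(q^2,q^8;q^{10})_\infty,$$ where $(a;q)_\infty=\prod_{k=0}^{\infty}(1-aq^k)$ and $(a_1,a_2;q)_\infty=(a_1;q)_\infty(a_2;q)_\infty$. Then for every integer $n\ge 0$: $$h_1(5n)>0,\qquad h_1(5n+2)>0\ (n\ne 1),\qquad h_1(5n+3)>0,\qquad h_1(5n+4)<0\ (n\ne 1).$$ Moreover, the signs of $h_1$ are eventually periodic with period $5$: there is an $N$ such that for all $n\ge N$ the numbers $h_1(n+5)$ and $h_1(n)$ have the same sign (positive, negative or zero). -/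

import Mathlib

open scoped PowerSeries PowerSeries.WithPiTopology

/-- The `q`-Pochhammer symbol `(a; b)_∞ = ∏_{n ≥ 0} (1 - a bⁿ)` of formal power series in the
variable `q = PowerSeries.X` with integer coefficients. The infinite product is taken in the topology
of coefficientwise convergence (`ℤ` being discrete); it converges whenever `b` has zero constant
coefficient, see `multipliable_qPochhammer`. -/
noncomputable def qPochhammer (a b : ℤ⟦X⟧) : ℤ⟦X⟧ :=
  ∏' n : ℕ, (1 - a * b ^ n)

/-- The product defining `(a; b)_∞` converges when `b` has zero constant coefficient. -/
theorem multipliable_qPochhammer (a b : ℤ⟦X⟧) (hb : PowerSeries.constantCoeff b = 0) :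
    Multipliable fun n : ℕ => 1 - a * b ^ n := by
  simp_rw [sub_eq_add_neg]
  apply PowerSeries.WithPiTopology.multipliable_one_add_of_tendsto_order_atTop_nhds_top
  refine ENat.tendsto_nhds_top_iff_natCast_lt.mpr
    (fun n => Filter.eventually_atTop.mpr ⟨n + 1, fun m hm => ?_⟩)
  rw [PowerSeries.order_neg]
  have h : PowerSeries.X ^ m ∣ a * b ^ m :=
    Dvd.dvd.mul_left (pow_dvd_pow_of_dvd (PowerSeries.X_dvd_iff.mpr hb) m) a
  have h2 : (m : ℕ∞) ≤ (a * b ^ m).order :=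
    PowerSeries.le_order _ _ fun i hi =>
      PowerSeries.X_pow_dvd_iff.mp h i (by exact_mod_cast hi)
  refine lt_of_lt_of_le ?_ h2
  exact_mod_cast hm

/-- The multi-parameter symbol `(a₁, a₂; b)_∞ = (a₁; b)_∞ (a₂; b)_∞`. -/
noncomputable def qPochhammer₂ (a₁ a₂ b : ℤ⟦X⟧) : ℤ⟦X⟧ :=
  qPochhammer a₁ b * qPochhammer a₂ b

open PowerSeries in
/-- The series `(-q², -q³; q⁵)_∞² (q², q⁸; q¹⁰)_∞`, with `q = X`. -/
noncomputable def h₁Series : ℤ⟦X⟧ :=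
  qPochhammer₂ (-X ^ 2) (-X ^ 3) (X ^ 5) ^ 2 * qPochhammer₂ (X ^ 2) (X ^ 8) (X ^ 10)

/-- `h₁ n` is the coefficient of `qⁿ` in `(-q², -q³; q⁵)_∞² (q², q⁸; q¹⁰)_∞`. -/
noncomputable def h₁ (n : ℕ) : ℤ :=
  PowerSeries.coeff n h₁Series

open PowerSeries

/-! Write `f(a, b) = ∑ a^(n(n+1)/2) b^(n(n-1)/2)` over all integers `n`, and `Q = q^5`. By Jacobi's
triple product (`jacobi_triple_product`), multiplying the generating function by `(Q;Q)_∞²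
(Q²;Q²)_∞`, a series in `Q`, turns it into `f(q^3,q^2)² f(-q^8,-q^2)`, a signed sum over `ℤ³`.

The quadratic part of twice its exponent is `5α² + 5β² + 10γ²`. An integer matrix of determinant 10
has columns orthogonal for this form, with values 50, 50 and 10. On each of the ten cosets of the
column lattice the sum therefore factors into a power of `q` times three theta series in `Q`. Two
cosets, those with exponents `1` modulo 5, contribute zero. The other eight pair up by the exponent
modulo 5, and the quadratic identities `mTheta_three_two_sq_eq`, `mTheta_four_one_sq_eq` and
`two_mul_mTheta_mul_mTheta_eq` turn each pair into a product.

Dividing back gives `h₁Series_eq`. With the Rogers–Ramanujan products `G = 1/(q,q^4;q^5)_∞` and `H =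
1/(q^2,q^3;q^5)_∞`, the series is `G(Q)²G(Q²) + q²H(Q)²G(Q²) + 2q³G(Q)H(Q)H(Q²) - q⁴H(Q)²H(Q²)`. All
four products have nonnegative coefficients and positive constant term. Every coefficient of `G(Q)`
is positive, and `H(Q)` lacks only `Q^1`, since 1 is the only natural number not of the form `2i +
3j`. The signs can then be read off; the coefficients at `5n + 1` vanish. -/

/-! ### Summable families in the `X`-adic sense. -/

/-- A family of power series only finitely many of which are nonzero modulo each `X ^ d`. -/
def Tame {ι : Type*} (f : ι → ℤ⟦X⟧) : Prop :=
  ∀ d : ℕ, {i | ¬ X ^ d ∣ f i}.Finite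

namespace Tame

variable {ι κ : Type*} {f : ι → ℤ⟦X⟧} {g : κ → ℤ⟦X⟧}

theorem summable (hf : Tame f) : Summable f := by
  rw [WithPiTopology.summable_iff_summable_coeff]
  intro d
  refine summable_of_hasFiniteSupport ((hf (d + 1)).subset fun i hi hd => hi ?_)
  exact X_pow_dvd_iff.mp hd d d.lt_succ_self

theorem prodMul (hf : Tame f) (hg : Tame g) : Tame fun p : ι × κ => f p.1 * g p.2 := by
  intro d
  refine ((hf d).prod (hg d)).subset fun p hp => ⟨fun h => hp ?_, fun h => hp ?_⟩
  · exact h.mul_right _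
  · exact h.mul_left _

theorem mul (hf : Tame f) (c : ι → ℤ⟦X⟧) : Tame fun i => f i * c i :=
  fun d => (hf d).subset fun _ hi h => hi (h.mul_right _)

theorem comp (hf : Tame f) {e : κ → ι} (he : Function.Injective e) : Tame fun k => f (e k) :=
  fun d => (hf d).preimage he.injOn

theorem tsum_mul (hf : Tame f) (hg : Tame g) :
    (∑' i, f i) * ∑' k, g k = ∑' p : ι × κ, f p.1 * g p.2 :=
  hf.summable.tsum_mul_tsum hg.summable (hf.prodMul hg).summable

/-- Splitting the index set into finitely many injectively parametrised classes. -/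
theorem tsum_eq_sum {σ : Type*} [Fintype σ] (hf : Tame f) (e : σ → κ → ι)
    (he : Function.Bijective fun p : σ × κ => e p.1 p.2) :
    ∑' i, f i = ∑ s, ∑' k, f (e s k) := by
  rw [← (Equiv.ofBijective _ he).tsum_eq f]
  have h : Summable fun p : σ × κ => f (e p.1 p.2) := (hf.comp he.injective).summable
  exact h.tsum_prod.trans (tsum_fintype _)

end Tame

theorem X_pow_dvd_tsum {ι : Type*} {f : ι → ℤ⟦X⟧} {d : ℕ} (hf : Summable f)
    (h : ∀ i, X ^ d ∣ f i) : X ^ d ∣ ∑' i, f i := by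
  refine X_pow_dvd_iff.mpr fun n hn => ?_
  rw [← ((WithPiTopology.hasSum_iff_hasSum_coeff ℤ).mp hf.hasSum n).tsum_eq]
  simp [fun i => X_pow_dvd_iff.mp (h i) n hn]

theorem eq_of_forall_X_pow_dvd_sub {f g : ℤ⟦X⟧} (h : ∀ N : ℕ, X ^ N ∣ f - g) : f = g := by
  refine sub_eq_zero.mp (PowerSeries.ext fun n => ?_)
  simpa using X_pow_dvd_iff.mp (h (n + 1)) n n.lt_succ_self

/-! ### Finite and infinite `q`-Pochhammer symbols. -/

/-- The finite `q`-Pochhammer symbol. -/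
noncomputable def finPoch (a b : ℤ⟦X⟧) (N : ℕ) : ℤ⟦X⟧ := ∏ n ∈ Finset.range N, (1 - a * b ^ n)

theorem finPoch_succ (a b : ℤ⟦X⟧) (N : ℕ) :
    finPoch a b (N + 1) = finPoch a b N * (1 - a * b ^ N) := Finset.prod_range_succ _ _

theorem tendsto_finPoch (a : ℤ⟦X⟧) {b : ℤ⟦X⟧} (hb : X ∣ b) :
    Filter.Tendsto (finPoch a b) Filter.atTop (nhds (qPochhammer a b)) :=
  (multipliable_qPochhammer a b (X_dvd_iff.mp hb)).hasProd.tendsto_prod_nat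

/-- The factors of index at least `N` are `1` modulo `X ^ N`, so the partial products are constant
modulo `X ^ N` from `N` on. -/
theorem X_pow_dvd_qPochhammer_sub (a : ℤ⟦X⟧) {b : ℤ⟦X⟧} (hb : X ∣ b) (N : ℕ) :
    X ^ N ∣ qPochhammer a b - finPoch a b N := by
  have key : ∀ M, X ^ N ∣ finPoch a b (N + M) - finPoch a b N := by
    intro M
    induction M with
    | zero => simp
    | succ M ih =>
      have h1 : X ^ N ∣ b ^ (N + M) :=
        (pow_dvd_pow _ (Nat.le_add_right N M)).trans (pow_dvd_pow_of_dvd hb _)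
      have h2 : finPoch a b (N + (M + 1)) - finPoch a b N
          = (finPoch a b (N + M) - finPoch a b N) - finPoch a b (N + M) * a * b ^ (N + M) := by
        rw [← add_assoc, finPoch_succ]; ring
      rw [h2]
      exact dvd_sub ih (h1.mul_left _)
  refine X_pow_dvd_iff.mpr fun n hn => ?_
  have h1 := (WithPiTopology.tendsto_iff_coeff_tendsto ℤ _ _ _).mp (tendsto_finPoch a hb) n
  have h2 : Filter.Tendsto (fun M => coeff n (finPoch a b M)) Filter.atTop
      (nhds (coeff n (finPoch a b N))) := by
    refine tendsto_const_nhds.congr' ?_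
    filter_upwards [Filter.eventually_ge_atTop N] with M hM
    obtain ⟨k, rfl⟩ := Nat.exists_eq_add_of_le hM
    have := X_pow_dvd_iff.mp (key k) n hn
    rw [map_sub] at this
    omega
  rw [map_sub, tendsto_nhds_unique h1 h2, sub_self]

theorem constantCoeff_finPoch {a : ℤ⟦X⟧} (ha : X ∣ a) (b : ℤ⟦X⟧) (N : ℕ) :
    constantCoeff (finPoch a b N) = 1 := by
  simp [finPoch, map_prod, X_dvd_iff.mp ha]

theorem constantCoeff_qPochhammer {a b : ℤ⟦X⟧} (ha : X ∣ a) (hb : X ∣ b) :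
    constantCoeff (qPochhammer a b) = 1 := by
  have h := X_pow_dvd_qPochhammer_sub a hb 1
  rw [pow_one, X_dvd_iff, map_sub, constantCoeff_finPoch ha] at h
  omega

theorem qPochhammer_ne_zero {a b : ℤ⟦X⟧} (ha : X ∣ a) (hb : X ∣ b) : qPochhammer a b ≠ 0 := by
  intro h
  have := constantCoeff_qPochhammer ha hb
  simp [h] at this

/-! ### Jacobi's triple product through its finite form. -/

/-- `1 / (p; p)_k`, extended by `0` to negative `k`. -/
noncomputable def invPoch (p : ℤ⟦X⟧) (k : ℤ) : ℤ⟦X⟧ :=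
  if 0 ≤ k then invOfUnit (finPoch p p k.toNat) 1 else 0

theorem invPoch_natCast_mul {p : ℤ⟦X⟧} (hp : X ∣ p) (k : ℕ) :
    invPoch p k * finPoch p p k = 1 := by
  rw [invPoch, if_pos (by positivity), Int.toNat_natCast]
  exact invOfUnit_mul _ _ (by simp [constantCoeff_finPoch hp])

theorem invPoch_of_neg (p : ℤ⟦X⟧) {k : ℤ} (hk : k < 0) : invPoch p k = 0 := by
  rw [invPoch, if_neg (by omega)]

/-- At `k = 0` both sides vanish, so the recurrence survives at the ends of the summation range in
`finTriple`. -/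
theorem invPoch_natCast_sub_one {p : ℤ⟦X⟧} (hp : X ∣ p) (k : ℕ) :
    invPoch p (k - 1) = (1 - p ^ k) * invPoch p k := by
  cases k with
  | zero => simp [invPoch_of_neg]
  | succ k =>
    have h1 := invPoch_natCast_mul hp k
    have h2 := invPoch_natCast_mul hp (k + 1)
    rw [finPoch_succ] at h2
    have h3 : ((k + 1 : ℕ) : ℤ) - 1 = (k : ℤ) := by push_cast; ring
    rw [h3]
    calc invPoch p k = invPoch p k * (invPoch p ↑(k + 1) * (finPoch p p k * (1 - p * p ^ k))) := by
          rw [h2, mul_one]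
      _ = (invPoch p k * finPoch p p k) * ((1 - p ^ (k + 1)) * invPoch p ↑(k + 1)) := by ring
      _ = _ := by rw [h1, one_mul]

/-- The triangular number `n (n + 1) / 2`, for an integer `n`. -/
def tri (n : ℤ) : ℕ := (n * (n + 1) / 2).toNat

theorem two_mul_tri (n : ℤ) : (2 * tri n : ℤ) = n * (n + 1) := by
  have h1 : 0 ≤ n * (n + 1) := by
    rcases le_or_gt 0 n with h | h <;> nlinarith
  have h2 := Int.even_mul_succ_self n
  rw [tri, Int.toNat_of_nonneg (by omega)]
  obtain ⟨k, hk⟩ := h2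
  omega

/-- The general term of Ramanujan's theta function. -/
noncomputable def rTerm (A B : ℤ⟦X⟧) (n : ℤ) : ℤ⟦X⟧ := A ^ tri n * B ^ tri (-n)

theorem X_pow_dvd_rTerm {A B : ℤ⟦X⟧} (hA : X ∣ A) (hB : X ∣ B) (n : ℤ) :
    X ^ n.natAbs ∣ rTerm A B n := by
  have h : n.natAbs ≤ tri n + tri (-n) := by
    have h1 := two_mul_tri n
    have h2 := two_mul_tri (-n)
    zify
    have : |n| ≤ n ^ 2 := by
      rw [← sq_abs]
      rcases eq_or_ne n 0 with rfl | h
      · simp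
      · have := Int.one_le_abs h
        nlinarith
    nlinarith
  refine (pow_dvd_pow _ h).trans ?_
  rw [pow_add]
  exact mul_dvd_mul (pow_dvd_pow_of_dvd hA _) (pow_dvd_pow_of_dvd hB _)

theorem tame_of_X_pow_natAbs_dvd {f : ℤ → ℤ⟦X⟧} (h : ∀ n, X ^ n.natAbs ∣ f n) : Tame f := by
  intro d
  refine (Set.finite_Icc (-(d : ℤ)) d).subset fun n hn => ?_
  by_contra hc
  refine hn ((pow_dvd_pow _ ?_).trans (h n))
  rw [Set.mem_Icc] at hc
  omega

theorem tame_rTerm {A B : ℤ⟦X⟧} (hA : X ∣ A) (hB : X ∣ B) : Tame (rTerm A B) :=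
  tame_of_X_pow_natAbs_dvd (X_pow_dvd_rTerm hA hB)

theorem rTerm_neg (A B : ℤ⟦X⟧) (n : ℤ) : rTerm A B (-n) = rTerm B A n := by
  rw [rTerm, rTerm, neg_neg, mul_comm]

theorem mul_rTerm_sub_one (A B : ℤ⟦X⟧) (N : ℕ) (m : ℤ) (k : ℕ) (hk : (k : ℤ) = N + 1 - m) :
    A * (A * B) ^ N * rTerm A B (m - 1) = (A * B) ^ k * rTerm A B m := by
  have h1 := two_mul_tri (m - 1)
  have h2 := two_mul_tri m
  have h3 := two_mul_tri (-(m - 1))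
  have h4 := two_mul_tri (-m)
  have e1 : 1 + N + tri (m - 1) = k + tri m := by zify; nlinarith
  have e2 : N + tri (-(m - 1)) = k + tri (-m) := by zify; nlinarith
  calc A * (A * B) ^ N * rTerm A B (m - 1)
      = A ^ (1 + N + tri (m - 1)) * B ^ (N + tri (-(m - 1))) := by rw [rTerm]; ring
    _ = A ^ (k + tri m) * B ^ (k + tri (-m)) := by rw [e1, e2]
    _ = _ := by rw [rTerm]; ring

/-- The sum in the finite form of the triple product identity. -/
noncomputable def finTriple (A B : ℤ⟦X⟧) (N M : ℕ) : ℤ⟦X⟧ :=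
  ∑' m : ℤ, rTerm A B m * (invPoch (A * B) (N - m) * invPoch (A * B) (M + m))

theorem finTriple_comm (A B : ℤ⟦X⟧) (N M : ℕ) : finTriple A B N M = finTriple B A M N := by
  rw [finTriple, finTriple, ← (Equiv.neg ℤ).tsum_eq]
  refine tsum_congr fun m => ?_
  rw [Equiv.neg_apply, rTerm_neg, mul_comm B A, sub_neg_eq_add, ← sub_eq_add_neg,
    mul_comm (invPoch _ _)]

/-- Put `p = A * B`, `k = N + 1 - m`, `l = M + m`. After shifting `m` in the second copy of the sum,
the two contributions are the term of the right-hand sum times `1 - p^k` and `p^k (1 - p^l)`, which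
add up to `1 - p^(k+l)`. -/
theorem finTriple_step {A B : ℤ⟦X⟧} (hA : X ∣ A) (hB : X ∣ B) (N M : ℕ) :
    (1 + A * (A * B) ^ N) * finTriple A B N M
      = (1 - (A * B) ^ (N + M + 1)) * finTriple A B (N + 1) M := by
  have hp : X ∣ A * B := hA.mul_right B
  have hT := tame_rTerm hA hB
  set i := invPoch (A * B) with hi
  have s1 : finTriple A B N M = ∑' m : ℤ, rTerm A B (m - 1) * (i (N - (m - 1)) * i (M + (m - 1))) :=
    ((Equiv.subRight (1 : ℤ)).tsum_eq
      fun m => rTerm A B m * (i (N - m) * i (M + m))).symm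
  have t1 : Tame fun m : ℤ => rTerm A B m * (i (N - m) * i (M + m)) := hT.mul _
  have t2 : Tame fun m : ℤ => rTerm A B (m - 1) * (i (N - (m - 1)) * i (M + (m - 1))) :=
    t1.comp (Equiv.subRight (1 : ℤ)).injective
  have t3 : Tame fun m : ℤ => rTerm A B m * (i (((N + 1 : ℕ) : ℤ) - m) * i (M + m)) := hT.mul _
  have e : (1 + A * (A * B) ^ N) * finTriple A B N M
      = finTriple A B N M + A * (A * B) ^ N * finTriple A B N M := by ring
  rw [e]
  nth_rewrite 2 [s1]
  rw [finTriple, finTriple, ← t2.summable.tsum_mul_left, ← t3.summable.tsum_mul_left,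
    ← t1.summable.tsum_add (t2.summable.mul_left _)]
  refine tsum_congr fun m => ?_
  rcases lt_or_ge ((N : ℤ) + 1) m with h | h
  · simp only [hi, invPoch_of_neg (A * B) (show (N : ℤ) - m < 0 by omega),
      invPoch_of_neg (A * B) (show (N : ℤ) - (m - 1) < 0 by omega),
      invPoch_of_neg (A * B) (show ((N + 1 : ℕ) : ℤ) - m < 0 by push_cast; omega)]
    ring
  rcases lt_or_ge ((M : ℤ) + m) 0 with h' | h'
  · simp only [hi, invPoch_of_neg (A * B) h',
      invPoch_of_neg (A * B) (show (M : ℤ) + (m - 1) < 0 by omega)]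
    ring
  obtain ⟨k, hk⟩ := Int.eq_ofNat_of_zero_le (show 0 ≤ (N : ℤ) + 1 - m by omega)
  obtain ⟨l, hl⟩ := Int.eq_ofNat_of_zero_le h'
  have a1 : (N : ℤ) - m = k - 1 := by omega
  have a2 : (N : ℤ) - (m - 1) = k := by omega
  have a3 : ((N + 1 : ℕ) : ℤ) - m = k := by push_cast; omega
  have a4 : (M : ℤ) + (m - 1) = l - 1 := by omega
  have a5 : N + M + 1 = k + l := by omega
  rw [a1, a2, a3, a4, hl, a5, hi, invPoch_natCast_sub_one hp, invPoch_natCast_sub_one hp,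
    ← mul_assoc (A * (A * B) ^ N), mul_rTerm_sub_one A B N m k hk.symm, pow_add]
  ring

/-- A form of the `q`-binomial theorem. `finTriple_step` raises `N`; the symmetry `finTriple_comm`
lets it raise `M` as well. -/
theorem finPoch_mul_finPoch {A B : ℤ⟦X⟧} (hA : X ∣ A) (hB : X ∣ B) (N M : ℕ) :
    finPoch (-A) (A * B) N * finPoch (-B) (A * B) M
      = finPoch (A * B) (A * B) (N + M) * finTriple A B N M := by
  have hp : X ∣ A * B := hA.mul_right B
  induction N with
  | zero =>
    induction M with
    | zero =>
      have h0 := invPoch_natCast_mul hp 0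
      have h : finTriple A B 0 0 = 1 := by
        rw [finTriple, tsum_eq_single (0 : ℤ)]
        · have h1 : invPoch (A * B) 0 = 1 := by simpa [finPoch] using h0
          simp [rTerm, tri, h1]
        · intro m hm
          rcases lt_or_gt_of_ne hm with h | h
          · rw [invPoch_of_neg _ (show ((0 : ℕ) : ℤ) + m < 0 by simpa using h)]; ring
          · rw [invPoch_of_neg _ (show ((0 : ℕ) : ℤ) - m < 0 by simpa using h)]; ring
      simp [h, finPoch]
    | succ M ih =>
      have h := finTriple_step hB hA M 0
      rw [finTriple_comm B A, finTriple_comm B A, mul_comm B A] at h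
      rw [finPoch_succ, ← mul_assoc, ih, ← add_assoc, finPoch_succ]
      linear_combination finPoch (A * B) (A * B) (0 + M) * h
  | succ N ih =>
    have h := finTriple_step hA hB N M
    have e : N + 1 + M = N + M + 1 := by ring
    rw [finPoch_succ, e, finPoch_succ]
    linear_combination (1 + A * (A * B) ^ N) * ih + finPoch (A * B) (A * B) (N + M) * h

theorem X_pow_dvd_qPochhammer_mul_invPoch {p : ℤ⟦X⟧} (hp : X ∣ p) (k : ℕ) :
    X ^ k ∣ qPochhammer p p * invPoch p k - 1 := by
  have h := (X_pow_dvd_qPochhammer_sub p hp k).mul_right (invPoch p k)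
  rwa [sub_mul, mul_comm (finPoch p p k), invPoch_natCast_mul hp] at h

/-- Jacobi's triple product identity. -/
theorem jacobi_triple_product {A B : ℤ⟦X⟧} (hA : X ∣ A) (hB : X ∣ B) :
    qPochhammer (-A) (A * B) * qPochhammer (-B) (A * B) * qPochhammer (A * B) (A * B)
      = ∑' n : ℤ, rTerm A B n := by
  have hp : X ∣ A * B := hA.mul_right B
  have hT := tame_rTerm hA hB
  refine eq_of_forall_X_pow_dvd_sub fun N => ?_
  set p := A * B with hpdef
  set P := qPochhammer p p
  obtain ⟨u, hu⟩ := X_pow_dvd_qPochhammer_sub (-A) hp N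
  obtain ⟨v, hv⟩ := X_pow_dvd_qPochhammer_sub (-B) hp N
  obtain ⟨w, hw⟩ := (pow_dvd_pow X (Nat.le_add_right N N)).trans
    (X_pow_dvd_qPochhammer_sub p hp (N + N))
  have hf := finPoch_mul_finPoch hA hB N N
  -- The two factors `P` cancel the two reciprocals modulo `X ^ (N - |m|)`, and the theta term
  -- supplies the missing `X ^ |m|`.
  have hs : X ^ N ∣ P * P * finTriple A B N N - ∑' n : ℤ, rTerm A B n := by
    have t1 : Tame fun m : ℤ => rTerm A B m * (invPoch p (N - m) * invPoch p (N + m)) := hT.mul _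
    rw [finTriple, ← t1.summable.tsum_mul_left,
      ← (t1.summable.mul_left _).tsum_sub hT.summable]
    refine X_pow_dvd_tsum ((t1.summable.mul_left _).sub hT.summable) fun m => ?_
    have hm := X_pow_dvd_rTerm hA hB m
    rcases lt_or_ge N m.natAbs with h | h
    · have h' := (pow_dvd_pow X h.le).trans hm
      exact dvd_sub ((h'.mul_right _).mul_left _) h'
    · obtain ⟨k, hk⟩ := Int.eq_ofNat_of_zero_le (show 0 ≤ (N : ℤ) - m by omega)
      obtain ⟨l, hl⟩ := Int.eq_ofNat_of_zero_le (show 0 ≤ (N : ℤ) + m by omega)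
      rw [hk, hl]
      have h1 := (pow_dvd_pow X (show N - m.natAbs ≤ k by omega)).trans
        (X_pow_dvd_qPochhammer_mul_invPoch hp k)
      have h2 := (pow_dvd_pow X (show N - m.natAbs ≤ l by omega)).trans
        (X_pow_dvd_qPochhammer_mul_invPoch hp l)
      have e : P * P * (rTerm A B m * (invPoch p k * invPoch p l)) - rTerm A B m
          = rTerm A B m * ((P * invPoch p k - 1) * (P * invPoch p l) + (P * invPoch p l - 1)) := by
        ring
      have e2 : N = m.natAbs + (N - m.natAbs) := by omega
      rw [e, e2, pow_add]
      exact mul_dvd_mul hm (dvd_add (h1.mul_right _) h2)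
  obtain ⟨y, hy⟩ := hs
  refine ⟨u * qPochhammer (-B) p * P + finPoch (-A) p N * v * P - P * finTriple A B N N * w + y, ?_⟩
  linear_combination qPochhammer (-B) p * P * hu + finPoch (-A) p N * P * hv
    - P * finTriple A B N N * hw + hy + P * hf

/-! ### Theta series with and without alternating signs. -/

/-- The exponent `i n (n + 1) / 2 + j n (n - 1) / 2`. -/
def thetaExp (i j : ℕ) (n : ℤ) : ℕ := i * tri n + j * tri (-n)

theorem two_mul_thetaExp (i j : ℕ) (n : ℤ) :
    (2 * thetaExp i j n : ℤ) = (i + j) * n ^ 2 + (i - j) * n := by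
  have h1 := two_mul_tri n
  have h2 := two_mul_tri (-n)
  rw [thetaExp]
  push_cast
  linear_combination (i : ℤ) * h1 + (j : ℤ) * h2

/-- The sign `(-1) ^ n` as a power series. -/
noncomputable def sgn (n : ℤ) : ℤ⟦X⟧ := ((n.negOnePow : ℤ) : ℤ⟦X⟧)

theorem sgn_add (m n : ℤ) : sgn (m + n) = sgn m * sgn n := by
  simp [sgn, Int.negOnePow_add]

theorem sgn_eq_of_even_sub {m n : ℤ} (h : Even (m - n)) : sgn m = sgn n := by
  rw [sgn, sgn, (Int.negOnePow_eq_iff m n).mpr h]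

theorem sgn_neg (n : ℤ) : sgn (-n) = sgn n := sgn_eq_of_even_sub ⟨-n, by ring⟩

theorem sgn_zero : sgn 0 = 1 := by simp [sgn]

theorem sgn_one : sgn 1 = -1 := by simp [sgn]

theorem sgn_neg_one : sgn (-1) = -1 := by rw [sgn_neg, sgn_one]

theorem neg_one_pow_eq_sgn (k : ℕ) : (-1 : ℤ⟦X⟧) ^ k = sgn k := by
  induction k with
  | zero => simp [sgn_zero]
  | succ k ih => rw [pow_succ, ih, Nat.cast_succ, sgn_add, sgn_one]

/-- The general term of the theta series `f(q ^ i, q ^ j)`. -/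
noncomputable def pTerm (q : ℤ⟦X⟧) (i j : ℕ) (n : ℤ) : ℤ⟦X⟧ := q ^ thetaExp i j n

/-- The general term of the alternating theta series `f(-q ^ i, -q ^ j)`. -/
noncomputable def mTerm (q : ℤ⟦X⟧) (i j : ℕ) (n : ℤ) : ℤ⟦X⟧ := sgn n * q ^ thetaExp i j n

/-- The theta series `f(q ^ i, q ^ j)`. -/
noncomputable def pTheta (q : ℤ⟦X⟧) (i j : ℕ) : ℤ⟦X⟧ := ∑' n : ℤ, pTerm q i j n

/-- The alternating theta series `f(-q ^ i, -q ^ j)`. -/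
noncomputable def mTheta (q : ℤ⟦X⟧) (i j : ℕ) : ℤ⟦X⟧ := ∑' n : ℤ, mTerm q i j n

theorem tame_pTerm {q : ℤ⟦X⟧} (hq : X ∣ q) {i : ℕ} (hi : 0 < i) (j : ℕ) : Tame (pTerm q i j) := by
  intro d
  -- `tri` is symmetric about `-1/2`, hence the asymmetric interval. Only the `i` part of the
  -- exponent is used, so `j = 0` is allowed.
  refine (Set.finite_Icc (-(d : ℤ) - 1) d).subset fun n hn => ?_
  by_contra hc
  refine hn ((pow_dvd_pow X ?_).trans (pow_dvd_pow_of_dvd hq _))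
  have h1 : tri n ≤ thetaExp i j n :=
    (Nat.le_mul_of_pos_left _ hi).trans (Nat.le_add_right _ _)
  refine le_trans ?_ h1
  have h2 := two_mul_tri n
  zify
  rw [Set.mem_Icc, not_and_or, not_le, not_le] at hc
  rcases hc with hc | hc <;> nlinarith

theorem tame_mTerm {q : ℤ⟦X⟧} (hq : X ∣ q) {i : ℕ} (hi : 0 < i) (j : ℕ) : Tame (mTerm q i j) := by
  have h := (tame_pTerm hq hi j).mul sgn
  simp only [pTerm, mul_comm _ (sgn _)] at h
  exact h

theorem thetaExp_neg (i j : ℕ) (n : ℤ) : thetaExp i j (-n) = thetaExp j i n := by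
  rw [thetaExp, thetaExp, neg_neg, add_comm]

theorem pTheta_comm (q : ℤ⟦X⟧) (i j : ℕ) : pTheta q i j = pTheta q j i := by
  rw [pTheta, ← (Equiv.neg ℤ).tsum_eq]
  simp [pTheta, pTerm, thetaExp_neg]

theorem mTheta_comm (q : ℤ⟦X⟧) (i j : ℕ) : mTheta q i j = mTheta q j i := by
  rw [mTheta, ← (Equiv.neg ℤ).tsum_eq]
  simp [mTheta, mTerm, thetaExp_neg, sgn_neg]

/-- The involution `n ↦ -1 - n` keeps the exponent and reverses the sign. This removes two of the
ten classes in the dissection. -/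
theorem mTheta_zero_right (q : ℤ⟦X⟧) (i : ℕ) : mTheta q i 0 = 0 := by
  have h : mTheta q i 0 = -mTheta q i 0 := by
    conv_lhs => rw [mTheta, ← (Equiv.subLeft (-1 : ℤ)).tsum_eq]
    rw [mTheta, ← tsum_neg]
    refine tsum_congr fun n => ?_
    have h1 : thetaExp i 0 (-1 - n) = thetaExp i 0 n := by
      have h1 := two_mul_thetaExp i 0 (-1 - n)
      have h2 := two_mul_thetaExp i 0 n
      zify
      push_cast at h1 h2
      linarith
    rw [Equiv.subLeft_apply, mTerm, mTerm, h1, sub_eq_add_neg, sgn_add, sgn_neg_one, sgn_neg]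
    ring
  ext n
  have h2 := congrArg (coeff n) h
  rw [map_neg] at h2
  rw [map_zero]
  omega

theorem mTheta_eq_qPochhammer {q : ℤ⟦X⟧} (hq : X ∣ q) {i j : ℕ} (hi : 0 < i) (hj : 0 < j) :
    mTheta q i j = qPochhammer (q ^ i) (q ^ (i + j)) * qPochhammer (q ^ j) (q ^ (i + j))
      * qPochhammer (q ^ (i + j)) (q ^ (i + j)) := by
  have h := jacobi_triple_product (A := -q ^ i) (B := -q ^ j)
    ((hq.trans (dvd_pow_self q hi.ne')).neg_right) ((hq.trans (dvd_pow_self q hj.ne')).neg_right)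
  rw [neg_neg, neg_neg, neg_mul_neg, ← pow_add] at h
  rw [h, mTheta]
  refine tsum_congr fun n => ?_
  -- `tri n + tri (-n) = n²` has the parity of `n`.
  have e : sgn n = sgn (tri n + tri (-n) : ℕ) := by
    have h1 := two_mul_tri n
    have h2 := two_mul_tri (-n)
    refine sgn_eq_of_even_sub ?_
    have h3 : n - (tri n + tri (-n) : ℕ) = -(n * (n - 1)) := by push_cast; linarith
    rw [h3]
    exact (Int.even_mul_pred_self n).neg
  rw [mTerm, rTerm, thetaExp, e, ← neg_one_pow_eq_sgn, neg_pow (q ^ i), neg_pow (q ^ j)]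
  ring

theorem pTheta_eq_qPochhammer {q : ℤ⟦X⟧} (hq : X ∣ q) {i j : ℕ} (hi : 0 < i) (hj : 0 < j) :
    pTheta q i j = qPochhammer (-q ^ i) (q ^ (i + j)) * qPochhammer (-q ^ j) (q ^ (i + j))
      * qPochhammer (q ^ (i + j)) (q ^ (i + j)) := by
  have h := jacobi_triple_product (A := q ^ i) (B := q ^ j)
    (hq.trans (dvd_pow_self q hi.ne')) (hq.trans (dvd_pow_self q hj.ne'))
  rw [← pow_add] at h
  rw [h, pTheta]
  refine tsum_congr fun n => ?_
  rw [pTerm, rTerm, thetaExp]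
  ring

theorem thetaExp_eq_zero_iff {i j : ℕ} (hi : 0 < i) (hj : 0 < j) (n : ℤ) :
    thetaExp i j n = 0 ↔ n = 0 := by
  have h1 := two_mul_tri n
  have h2 := two_mul_tri (-n)
  constructor
  · intro h
    rw [thetaExp, Nat.add_eq_zero_iff, mul_eq_zero, mul_eq_zero] at h
    have h3 : tri n = 0 := by omega
    have h4 : tri (-n) = 0 := by omega
    rw [h3] at h1
    rw [h4] at h2
    push_cast at h1 h2
    linarith
  · rintro rfl
    simp [thetaExp, tri]

theorem constantCoeff_tsum {f : ℤ → ℤ⟦X⟧} (hf : Tame f) :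
    constantCoeff (∑' n, f n) = ∑' n, constantCoeff (f n) :=
  hf.summable.map_tsum _ (WithPiTopology.continuous_constantCoeff ℤ)

theorem constantCoeff_pow_of_X_dvd {q : ℤ⟦X⟧} (hq : X ∣ q) {k : ℕ} (hk : k ≠ 0) :
    constantCoeff (q ^ k) = 0 := by
  rw [map_pow, X_dvd_iff.mp hq, zero_pow hk]

theorem constantCoeff_mTheta {q : ℤ⟦X⟧} (hq : X ∣ q) {i j : ℕ} (hi : 0 < i) (hj : 0 < j) :
    constantCoeff (mTheta q i j) = 1 := by
  rw [mTheta, constantCoeff_tsum (tame_mTerm hq hi j), tsum_eq_single (0 : ℤ)]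
  · simp [mTerm, thetaExp, tri, sgn_zero]
  · intro n hn
    rw [mTerm, map_mul, constantCoeff_pow_of_X_dvd hq
      (fun h => hn ((thetaExp_eq_zero_iff hi hj n).mp h)), mul_zero]

theorem constantCoeff_pTheta {q : ℤ⟦X⟧} (hq : X ∣ q) {i j : ℕ} (hi : 0 < i) (hj : 0 < j) :
    constantCoeff (pTheta q i j) = 1 := by
  rw [pTheta, constantCoeff_tsum (tame_pTerm hq hi j), tsum_eq_single (0 : ℤ)]
  · simp [pTerm, thetaExp, tri]
  · intro n hn
    rw [pTerm, constantCoeff_pow_of_X_dvd hq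
      (fun h => hn ((thetaExp_eq_zero_iff hi hj n).mp h))]

/-- Both `n = 0` and `n = -1` have exponent zero. -/
theorem constantCoeff_pTheta_zero_right {q : ℤ⟦X⟧} (hq : X ∣ q) {i : ℕ} (hi : 0 < i) :
    constantCoeff (pTheta q i 0) = 2 := by
  rw [pTheta, constantCoeff_tsum (tame_pTerm hq hi 0), tsum_eq_sum (s := {0, -1})]
  · rw [Finset.sum_pair (by norm_num)]
    simp [pTerm, thetaExp, tri]
  · intro n hn
    rw [pTerm, constantCoeff_pow_of_X_dvd hq]
    intro h
    have h1 := two_mul_thetaExp i 0 n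
    rw [h] at h1
    have h2 : (i : ℤ) * (n * (n + 1)) = 0 := by push_cast at h1; linarith
    simp only [mul_eq_zero, Nat.cast_eq_zero, hi.ne', false_or] at h2
    simp only [Finset.mem_insert, Finset.mem_singleton] at hn
    omega

/-! ### Quadratic theta identities from splittings of `ℤ × ℤ`. -/

/-- Evaluation of a product of two series by splitting the index set `ℤ × ℤ` into classes. -/
theorem tsum_mul_tsum_split {σ : Type*} [Fintype σ] {f g : ℤ → ℤ⟦X⟧} (hf : Tame f) (hg : Tame g)
    (e : σ → ℤ × ℤ → ℤ × ℤ) (he : Function.Bijective fun p : σ × (ℤ × ℤ) => e p.1 p.2)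
    (c : σ → ℤ⟦X⟧) {u v : σ → ℤ → ℤ⟦X⟧} (hu : ∀ s, Tame (u s)) (hv : ∀ s, Tame (v s))
    (h : ∀ s m n, f (e s (m, n)).1 * g (e s (m, n)).2 = c s * (u s m * v s n)) :
    (∑' n, f n) * ∑' n, g n = ∑ s, c s * ((∑' n, u s n) * ∑' n, v s n) := by
  rw [hf.tsum_mul hg, (hf.prodMul hg).tsum_eq_sum e he]
  refine Finset.sum_congr rfl fun s _ => ?_
  rw [(hu s).tsum_mul (hv s), ← ((hu s).prodMul (hv s)).summable.tsum_mul_left]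
  exact tsum_congr fun p => h s p.1 p.2

theorem pTerm_mul_pTerm {i j i' j' k l k' l' d : ℕ} {x y m n : ℤ}
    (h : thetaExp i j x + thetaExp i' j' y = d + (thetaExp k l m + thetaExp k' l' n)) (q : ℤ⟦X⟧) :
    pTerm q i j x * pTerm q i' j' y = q ^ d * (pTerm q k l m * pTerm q k' l' n) := by
  simp only [pTerm, ← pow_add, h]

theorem mTerm_mul_mTerm {i j i' j' k l k' l' d : ℕ} {x y m n : ℤ}
    (h : thetaExp i j x + thetaExp i' j' y = d + (thetaExp k l m + thetaExp k' l' n)) (q : ℤ⟦X⟧) :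
    mTerm q i j x * mTerm q i' j' y
      = sgn (x + y) * q ^ d * (pTerm q k l m * pTerm q k' l' n) := by
  rw [mul_assoc, ← pTerm_mul_pTerm h, sgn_add]
  simp only [mTerm, pTerm]
  ring

theorem thetaExp_add_eq {i j i' j' k l k' l' d : ℕ} {x y m n : ℤ}
    (h : ((i : ℤ) + j) * x ^ 2 + (i - j) * x + ((i' + j') * y ^ 2 + (i' - j') * y)
      = 2 * d + ((k + l) * m ^ 2 + (k - l) * m + ((k' + l') * n ^ 2 + (k' - l') * n))) :
    thetaExp i j x + thetaExp i' j' y = d + (thetaExp k l m + thetaExp k' l' n) := by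
  have h1 := two_mul_thetaExp i j x
  have h2 := two_mul_thetaExp i' j' y
  have h3 := two_mul_thetaExp k l m
  have h4 := two_mul_thetaExp k' l' n
  zify
  linarith

/-- The parametrisation of `ℤ × ℤ` by sums and differences, split by parity. -/
def paritySplit (s : Fin 2) (p : ℤ × ℤ) : ℤ × ℤ :=
  ![(p.1 + p.2, p.1 - p.2), (p.1 - p.2 - 1, p.1 + p.2)] s

theorem bijective_paritySplit :
    Function.Bijective fun p : Fin 2 × (ℤ × ℤ) => paritySplit p.1 p.2 := by
  constructor
  · rintro ⟨s, m, n⟩ ⟨s', m', n'⟩ h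
    fin_cases s <;> fin_cases s' <;> simp [paritySplit] at h ⊢ <;> omega
  · rintro ⟨x, y⟩
    rcases Int.even_or_odd' (x + y) with ⟨k, h | h⟩
    · exact ⟨(0, k, k - y), by simp [paritySplit]; omega⟩
    · exact ⟨(1, k + 1, y - k - 1), by simp [paritySplit]; omega⟩

/-- The parametrisation of `ℤ × ℤ` by the classes modulo the multiples of the Gaussian integer
`2 + i`, adapted to squares. -/
def gaussSplit (s : Fin 5) (p : ℤ × ℤ) : ℤ × ℤ :=
  ![(2 * p.1 - p.2, p.1 + 2 * p.2), (2 * p.1 - p.2 + 1, p.1 + 2 * p.2),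
    (2 * p.1 - p.2 - 1, p.1 + 2 * p.2), (2 * p.1 - p.2, p.1 + 2 * p.2 + 1),
    (2 * p.1 - p.2, p.1 + 2 * p.2 - 1)] s

theorem bijective_gaussSplit :
    Function.Bijective fun p : Fin 5 × (ℤ × ℤ) => gaussSplit p.1 p.2 := by
  constructor
  · rintro ⟨s, m, n⟩ ⟨s', m', n'⟩ h
    fin_cases s <;> fin_cases s' <;> simp [gaussSplit] at h ⊢ <;> omega
  · rintro ⟨x, y⟩
    obtain ⟨k, h | h | h | h | h⟩ : ∃ k, 2 * x + y = 5 * k ∨ 2 * x + y = 5 * k + 2 ∨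
        2 * x + y = 5 * k - 2 ∨ 2 * x + y = 5 * k + 1 ∨ 2 * x + y = 5 * k - 1 :=
      ⟨(2 * x + y + 2) / 5, by omega⟩
    · exact ⟨(0, k, 2 * k - x), by simp [gaussSplit]; omega⟩
    · exact ⟨(1, k, 2 * k - x + 1), by simp [gaussSplit]; omega⟩
    · exact ⟨(2, k, 2 * k - x - 1), by simp [gaussSplit]; omega⟩
    · exact ⟨(3, k, 2 * k - x), by simp [gaussSplit]; omega⟩
    · exact ⟨(4, k, 2 * k - x), by simp [gaussSplit]; omega⟩

/-- The parametrisation of `ℤ × ℤ` by the classes modulo the multiples of the Gaussian integer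
`2 + i`, adapted to products of consecutive integers. -/
def gaussSplit' (s : Fin 5) (p : ℤ × ℤ) : ℤ × ℤ :=
  ![(2 * p.1 - p.2, p.1 + 2 * p.2 + 1), (2 * p.1 - p.2, p.1 + 2 * p.2),
    (2 * p.1 - p.2 - 1, p.1 + 2 * p.2), (2 * p.1 - p.2, p.1 + 2 * p.2 - 1),
    (2 * p.1 - p.2 - 1, p.1 + 2 * p.2 - 1)] s

theorem bijective_gaussSplit' :
    Function.Bijective fun p : Fin 5 × (ℤ × ℤ) => gaussSplit' p.1 p.2 := by
  constructor
  · rintro ⟨s, m, n⟩ ⟨s', m', n'⟩ h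
    fin_cases s <;> fin_cases s' <;> simp [gaussSplit'] at h ⊢ <;> omega
  · rintro ⟨x, y⟩
    obtain ⟨k, h | h | h | h | h⟩ : ∃ k, 2 * x + y = 5 * k + 1 ∨ 2 * x + y = 5 * k ∨
        2 * x + y = 5 * k - 2 ∨ 2 * x + y = 5 * k - 1 ∨ 2 * x + y = 5 * k - 3 :=
      ⟨(2 * x + y + 3) / 5, by omega⟩
    · exact ⟨(0, k, 2 * k - x), by simp [gaussSplit']; omega⟩
    · exact ⟨(1, k, 2 * k - x), by simp [gaussSplit']; omega⟩
    · exact ⟨(2, k, 2 * k - x - 1), by simp [gaussSplit']; omega⟩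
    · exact ⟨(3, k, 2 * k - x), by simp [gaussSplit']; omega⟩
    · exact ⟨(4, k, 2 * k - x - 1), by simp [gaussSplit']; omega⟩

/-- The sign `(-1)^(x+y)` is constant on each parity class of `x + y`, so a product of alternating
series becomes a difference of products of series without signs. -/
theorem mTheta_mul_mTheta_split {q : ℤ⟦X⟧} (hq : X ∣ q) {i j i' j' k l k' l' r t r' t' d : ℕ} (hi : 0 < i) (hi' : 0 < i')
    (hk : 0 < k) (hk' : 0 < k') (hr : 0 < r) (hr' : 0 < r')
    (h0 : ∀ m n, thetaExp i j (m + n) + thetaExp i' j' (m - n)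
      = 0 + (thetaExp k l m + thetaExp k' l' n))
    (h1 : ∀ m n, thetaExp i j (m - n - 1) + thetaExp i' j' (m + n)
      = d + (thetaExp r t m + thetaExp r' t' n)) :
    mTheta q i j * mTheta q i' j'
      = pTheta q k l * pTheta q k' l' - q ^ d * (pTheta q r t * pTheta q r' t') := by
  have h := tsum_mul_tsum_split (tame_mTerm hq hi j) (tame_mTerm hq hi' j') paritySplit
    bijective_paritySplit ![1, -q ^ d] (u := ![pTerm q k l, pTerm q r t])
    (v := ![pTerm q k' l', pTerm q r' t'])
    (by simp [Fin.forall_fin_two, tame_pTerm hq, *]) (by simp [Fin.forall_fin_two, tame_pTerm hq, *])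
    (by
      simp only [Fin.forall_fin_two]
      refine ⟨fun m n => ?_, fun m n => ?_⟩
      · have e : sgn (m + n + (m - n)) = 1 := by
          rw [sgn_eq_of_even_sub (n := 0) ⟨m, by ring⟩, sgn_zero]
        have h2 := mTerm_mul_mTerm (h0 m n) q
        rw [e] at h2
        simpa [paritySplit] using h2
      · have e : sgn (m - n - 1 + (m + n)) = -1 := by
          rw [sgn_eq_of_even_sub (n := -1) ⟨m, by ring⟩, sgn_neg_one]
        have h2 := mTerm_mul_mTerm (h1 m n) q
        rw [e] at h2
        simpa [paritySplit] using h2)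
  rw [mTheta, mTheta, h, Fin.sum_univ_two]
  simp [pTheta]
  ring

theorem mTheta_three_two_sq {q : ℤ⟦X⟧} (hq : X ∣ q) : mTheta q 3 2 ^ 2
    = pTheta q 6 4 * pTheta q 5 5 - q ^ 2 * (pTheta q 9 1 * pTheta q 10 0) := by
  rw [sq, pTheta_comm q 9 1]
  apply mTheta_mul_mTheta_split hq <;> first
    | (intro m n; apply thetaExp_add_eq; push_cast; ring)
    | norm_num

theorem mTheta_four_one_sq {q : ℤ⟦X⟧} (hq : X ∣ q) : mTheta q 4 1 ^ 2
    = pTheta q 8 2 * pTheta q 5 5 - q * (pTheta q 7 3 * pTheta q 10 0) := by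
  rw [sq, pTheta_comm q 7 3, ← pow_one (q * _), mul_pow, pow_one (_ * _)]
  apply mTheta_mul_mTheta_split hq <;> first
    | (intro m n; apply thetaExp_add_eq; push_cast; ring)
    | norm_num

theorem mTheta_four_one_mul_mTheta_three_two {q : ℤ⟦X⟧} (hq : X ∣ q) : mTheta q 4 1 * mTheta q 3 2
    = pTheta q 7 3 * pTheta q 6 4 - q * (pTheta q 8 2 * pTheta q 9 1) := by
  rw [pTheta_comm q 8 2, ← pow_one (q * _), mul_pow, pow_one (_ * _)]
  apply mTheta_mul_mTheta_split hq <;> first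
    | (intro m n; apply thetaExp_add_eq; push_cast; ring)
    | norm_num

/-- The exponent `x² + y²` is the norm of `x + iy`, and multiplication by `2 + i` scales it by 5.
The residues `±1, ±i` contribute equally, whence the factor 4. -/
theorem pTheta_one_one_sq {q : ℤ⟦X⟧} (hq : X ∣ q) : pTheta q 1 1 ^ 2
    = pTheta q 5 5 ^ 2 + 4 * q * (pTheta q 9 1 * pTheta q 7 3) := by
  have h := tsum_mul_tsum_split (tame_pTerm hq one_pos 1) (tame_pTerm hq one_pos 1) gaussSplit
    bijective_gaussSplit ![q ^ 0, q ^ 1, q ^ 1, q ^ 1, q ^ 1]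
    (u := ![pTerm q 5 5, pTerm q 9 1, pTerm q 1 9, pTerm q 7 3, pTerm q 3 7])
    (v := ![pTerm q 5 5, pTerm q 3 7, pTerm q 7 3, pTerm q 9 1, pTerm q 1 9])
    (by simp [Fin.forall_fin_succ, tame_pTerm hq]) (by simp [Fin.forall_fin_succ, tame_pTerm hq])
    (by
      simp only [Fin.forall_fin_succ]
      refine ⟨?_, ?_, ?_, ?_, ?_, fun i => i.elim0⟩ <;>
        (intro m n; apply pTerm_mul_pTerm; apply thetaExp_add_eq; simp [gaussSplit]; ring))
  rw [sq, pTheta, h, Fin.sum_univ_five]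
  have e1 := pTheta_comm q 9 1
  have e2 := pTheta_comm q 7 3
  simp only [pTheta] at e1 e2
  simp [pTheta, e1, e2]
  ring

/-- The same argument for the norm centred at `(-1/2, -1/2)`: the class of multiples of `2 + i`
gives the `q ^ 2` term, and the other four contribute equally. -/
theorem pTheta_two_zero_sq {q : ℤ⟦X⟧} (hq : X ∣ q) : pTheta q 2 0 ^ 2
    = q ^ 2 * pTheta q 10 0 ^ 2 + 4 * (pTheta q 6 4 * pTheta q 8 2) := by
  have h := tsum_mul_tsum_split (tame_pTerm hq two_pos 0) (tame_pTerm hq two_pos 0) gaussSplit'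
    bijective_gaussSplit' ![q ^ 2, q ^ 0, q ^ 0, q ^ 0, q ^ 0]
    (u := ![pTerm q 10 0, pTerm q 8 2, pTerm q 4 6, pTerm q 6 4, pTerm q 2 8])
    (v := ![pTerm q 10 0, pTerm q 6 4, pTerm q 8 2, pTerm q 2 8, pTerm q 4 6])
    (by simp [Fin.forall_fin_succ, tame_pTerm hq]) (by simp [Fin.forall_fin_succ, tame_pTerm hq])
    (by
      simp only [Fin.forall_fin_succ]
      refine ⟨?_, ?_, ?_, ?_, ?_, fun i => i.elim0⟩ <;>
        (intro m n; apply pTerm_mul_pTerm; apply thetaExp_add_eq; simp [gaussSplit']; ring))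
  rw [sq, pTheta, h, Fin.sum_univ_five]
  have e1 := pTheta_comm q 6 4
  have e2 := pTheta_comm q 8 2
  simp only [pTheta] at e1 e2
  simp [pTheta, e1, e2]
  ring

/-- The difference of the two right-hand terms is `r`, from the parity splittings. Adding four times
their product to its square gives the square of their sum, which `pTheta_two_zero_sq` identifies
with the square of the left side. -/
theorem pTheta_two_zero_mul {q : ℤ⟦X⟧} (hq : X ∣ q) : pTheta q 2 0 * (mTheta q 4 1 * mTheta q 3 2)
    = mTheta q 3 2 ^ 2 * pTheta q 8 2 + mTheta q 4 1 ^ 2 * pTheta q 6 4 := by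
  have w1 := mTheta_three_two_sq hq
  have w2 := mTheta_four_one_sq hq
  have w3 := mTheta_four_one_mul_mTheta_three_two hq
  have k1 := pTheta_two_zero_sq hq
  set a := mTheta q 4 1
  set b := mTheta q 3 2
  have r : b ^ 2 * pTheta q 8 2 - a ^ 2 * pTheta q 6 4 = q * pTheta q 10 0 * (a * b) := by
    rw [w1, w2, w3]; ring
  have h : (pTheta q 2 0 * (a * b)) ^ 2 = (b ^ 2 * pTheta q 8 2 + a ^ 2 * pTheta q 6 4) ^ 2 := by
    linear_combination (a * b) ^ 2 * k1
      - (b ^ 2 * pTheta q 8 2 - a ^ 2 * pTheta q 6 4 + q * pTheta q 10 0 * (a * b)) * r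
  rcases sq_eq_sq_iff_eq_or_eq_neg.mp h with h | h
  · exact h
  -- Both constant terms are `2`, which excludes the negative root.
  · have h2 := congrArg constantCoeff h
    simp [a, b, constantCoeff_mTheta hq, constantCoeff_pTheta hq,
      constantCoeff_pTheta_zero_right hq] at h2

theorem pTheta_one_one_mul {q : ℤ⟦X⟧} (hq : X ∣ q) : pTheta q 1 1 * (mTheta q 4 1 * mTheta q 3 2)
    = mTheta q 3 2 ^ 2 * pTheta q 7 3 + q * (mTheta q 4 1 ^ 2 * pTheta q 9 1) := by
  have w1 := mTheta_three_two_sq hq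
  have w2 := mTheta_four_one_sq hq
  have w3 := mTheta_four_one_mul_mTheta_three_two hq
  have k1 := pTheta_one_one_sq hq
  set a := mTheta q 4 1
  set b := mTheta q 3 2
  have r : b ^ 2 * pTheta q 7 3 - q * (a ^ 2 * pTheta q 9 1) = pTheta q 5 5 * (a * b) := by
    rw [w1, w2, w3]; ring
  have h : (pTheta q 1 1 * (a * b)) ^ 2
      = (b ^ 2 * pTheta q 7 3 + q * (a ^ 2 * pTheta q 9 1)) ^ 2 := by
    linear_combination (a * b) ^ 2 * k1
      - (b ^ 2 * pTheta q 7 3 - q * (a ^ 2 * pTheta q 9 1) + pTheta q 5 5 * (a * b)) * r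
  rcases sq_eq_sq_iff_eq_or_eq_neg.mp h with h | h
  · exact h
  · have h2 := congrArg constantCoeff h
    simp [a, b, constantCoeff_mTheta hq, constantCoeff_pTheta hq, X_dvd_iff.mp hq] at h2

theorem mTheta_ne_zero {q : ℤ⟦X⟧} (hq : X ∣ q) {i j : ℕ} (hi : 0 < i) (hj : 0 < j) : mTheta q i j ≠ 0 := by
  intro h
  have := constantCoeff_mTheta hq hi hj
  simp [h] at this

theorem mTheta_mul_mTheta_ne_zero {q : ℤ⟦X⟧} (hq : X ∣ q) : mTheta q 4 1 * mTheta q 3 2 ≠ 0 :=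
  mul_ne_zero (mTheta_ne_zero hq (by norm_num) (by norm_num))
    (mTheta_ne_zero hq (by norm_num) (by norm_num))

/-- After multiplication by `mTheta q 4 1 * mTheta q 3 2`, the relations `pTheta_one_one_mul` and
`pTheta_two_zero_mul` apply; the terms in `mTheta q 4 1 ^ 2` cancel and the parity splitting
evaluates the rest. -/
theorem mTheta_three_two_sq_eq {q : ℤ⟦X⟧} (hq : X ∣ q) : pTheta q 1 1 * pTheta q 6 4 - q * (pTheta q 2 0 * pTheta q 9 1)
    = mTheta q 3 2 ^ 2 := by
  refine mul_right_cancel₀ (mTheta_mul_mTheta_ne_zero hq) ?_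
  have w3 := mTheta_four_one_mul_mTheta_three_two hq
  linear_combination pTheta q 6 4 * pTheta_one_one_mul hq
    - q * pTheta q 9 1 * pTheta_two_zero_mul hq - mTheta q 3 2 ^ 2 * w3

theorem mTheta_four_one_sq_eq {q : ℤ⟦X⟧} (hq : X ∣ q) : pTheta q 2 0 * pTheta q 7 3 - pTheta q 1 1 * pTheta q 8 2
    = mTheta q 4 1 ^ 2 := by
  refine mul_right_cancel₀ (mTheta_mul_mTheta_ne_zero hq) ?_
  have w3 := mTheta_four_one_mul_mTheta_three_two hq
  linear_combination pTheta q 7 3 * pTheta_two_zero_mul hq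
    - pTheta q 8 2 * pTheta_one_one_mul hq - mTheta q 4 1 ^ 2 * w3

theorem two_mul_mTheta_mul_mTheta_eq {q : ℤ⟦X⟧} (hq : X ∣ q) :
    pTheta q 5 5 * pTheta q 2 0 - q * (pTheta q 1 1 * pTheta q 10 0)
      = 2 * (mTheta q 4 1 * mTheta q 3 2) := by
  refine mul_right_cancel₀ (mTheta_mul_mTheta_ne_zero hq) ?_
  linear_combination pTheta q 5 5 * pTheta_two_zero_mul hq
    - q * pTheta q 10 0 * pTheta_one_one_mul hq
    - mTheta q 4 1 ^ 2 * mTheta_three_two_sq hq - mTheta q 3 2 ^ 2 * mTheta_four_one_sq hq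

/-! ### The dissection of the ternary theta product. -/

/-- Evaluation of a product of three series by splitting the index set into classes. -/
theorem tsum_mul_tsum_mul_tsum_split {σ : Type*} [Fintype σ] {f g h : ℤ → ℤ⟦X⟧} (hf : Tame f)
    (hg : Tame g) (hh : Tame h) (e : σ → ℤ × ℤ × ℤ → ℤ × ℤ × ℤ)
    (he : Function.Bijective fun p : σ × (ℤ × ℤ × ℤ) => e p.1 p.2)
    (c : σ → ℤ⟦X⟧) {u v w : σ → ℤ → ℤ⟦X⟧} (hu : ∀ s, Tame (u s)) (hv : ∀ s, Tame (v s))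
    (hw : ∀ s, Tame (w s))
    (H : ∀ s x m n, f (e s (x, m, n)).1 * (g (e s (x, m, n)).2.1 * h (e s (x, m, n)).2.2)
      = c s * (u s x * (v s m * w s n))) :
    (∑' n, f n) * ((∑' n, g n) * ∑' n, h n)
      = ∑ s, c s * ((∑' n, u s n) * ((∑' n, v s n) * ∑' n, w s n)) := by
  rw [hg.tsum_mul hh, hf.tsum_mul (hg.prodMul hh),
    (hf.prodMul (hg.prodMul hh)).tsum_eq_sum e he]
  refine Finset.sum_congr rfl fun s _ => ?_
  rw [(hv s).tsum_mul (hw s), (hu s).tsum_mul ((hv s).prodMul (hw s)),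
    ← ((hu s).prodMul ((hv s).prodMul (hw s))).summable.tsum_mul_left]
  exact tsum_congr fun p => H s p.1 p.2.1 p.2.2

/-- Representatives of the ten classes of `ℤ³` used in the dissection. -/
def ternaryShift : Fin 10 → ℤ × ℤ × ℤ :=
  ![(0, 0, 0), (1, 0, -1), (1, 1, 0), (1, 0, 1), (-1, -1, 0), (0, -1, -1), (0, 0, 1), (1, 0, 0),
    (0, 0, -1), (0, -1, 0)]

/-- The parametrisation of the ten classes of `ℤ³` used in the dissection. -/
def ternarySplit (s : Fin 10) (p : ℤ × ℤ × ℤ) : ℤ × ℤ × ℤ :=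
  (2 * p.1 - p.2.1 + p.2.2 + (ternaryShift s).1, 2 * p.1 - p.2.1 - p.2.2 + (ternaryShift s).2.1,
    p.1 + 2 * p.2.1 + (ternaryShift s).2.2)

/-- The residue modulo `10` that distinguishes the classes. -/
def ternaryResidue (s : Fin 10) : ℤ :=
  4 * (ternaryShift s).2.2 - (ternaryShift s).1 - (ternaryShift s).2.1

theorem eq_of_ten_dvd_ternaryResidue_sub :
    ∀ s t : Fin 10, (10 : ℤ) ∣ ternaryResidue s - ternaryResidue t → s = t := by
  decide

theorem exists_ternaryResidue (r : ℤ) : ∃ s k, r = 10 * k + ternaryResidue s := by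
  have h : ∀ t : Fin 10, ∃ s, (10 : ℤ) ∣ (t : ℕ) - ternaryResidue s := by decide
  obtain ⟨t, ht⟩ := Int.eq_ofNat_of_zero_le (Int.emod_nonneg r (by norm_num : (10 : ℤ) ≠ 0))
  obtain ⟨s, k, hk⟩ := h ⟨t, by omega⟩
  exact ⟨s, r / 10 + k, by simp only at hk; omega⟩

/-- The functional `4c - a - b` equals `10 m` on the column lattice, which has index 10, so modulo
10 it separates the cosets. -/
theorem bijective_ternarySplit :
    Function.Bijective fun p : Fin 10 × (ℤ × ℤ × ℤ) => ternarySplit p.1 p.2 := by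
  constructor
  · rintro ⟨s, x, m, n⟩ ⟨t, x', m', n'⟩ h
    simp only [ternarySplit, Prod.mk.injEq] at h
    obtain ⟨h1, h2, h3⟩ := h
    obtain rfl := eq_of_ten_dvd_ternaryResidue_sub s t
      ⟨m' - m, by simp only [ternaryResidue]; linarith⟩
    simp only [Prod.mk.injEq, true_and]
    omega
  · rintro ⟨a, b, c⟩
    obtain ⟨s, m, hm⟩ := exists_ternaryResidue (4 * c - a - b)
    simp only [ternaryResidue] at hm
    refine ⟨(s, c - 2 * m - (ternaryShift s).2.2,
      m, a - 2 * (c - 2 * m - (ternaryShift s).2.2) + m - (ternaryShift s).1), ?_⟩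
    simp only [ternarySplit, Prod.mk.injEq]
    refine ⟨?_, ?_, ?_⟩ <;> linarith

/-- Since `γ ≡ x + ε` modulo 2, only the series in `x` keeps its alternating sign. -/
theorem ternary_term_eq {i j i' j' k l k' l' r t d : ℕ} {α β γ x m n ε : ℤ}
    (hε : γ = x + 2 * m + ε)
    (h : ((i : ℤ) + j) * α ^ 2 + (i - j) * α + ((i + j) * β ^ 2 + (i - j) * β)
      + ((i' + j') * γ ^ 2 + (i' - j') * γ)
      = 2 * d + 5 * ((k + l) * x ^ 2 + (k - l) * x + ((k' + l') * m ^ 2 + (k' - l') * m)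
        + ((r + t) * n ^ 2 + (r - t) * n))) :
    pTerm X i j α * (pTerm X i j β * mTerm X i' j' γ)
      = sgn ε * X ^ d * (mTerm (X ^ 5) k l x * (pTerm (X ^ 5) k' l' m * pTerm (X ^ 5) r t n)) := by
  have h1 := two_mul_thetaExp i j α
  have h2 := two_mul_thetaExp i j β
  have h3 := two_mul_thetaExp i' j' γ
  have h4 := two_mul_thetaExp k l x
  have h5 := two_mul_thetaExp k' l' m
  have h6 := two_mul_thetaExp r t n
  have e : thetaExp i j α + thetaExp i j β + thetaExp i' j' γ
      = d + 5 * (thetaExp k l x + thetaExp k' l' m + thetaExp r t n) := by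
    zify
    linarith
  have e2 : sgn γ = sgn ε * sgn x := by
    rw [← sgn_add]
    exact sgn_eq_of_even_sub ⟨m, by rw [hε]; ring⟩
  calc pTerm X i j α * (pTerm X i j β * mTerm X i' j' γ)
      = sgn γ * X ^ (thetaExp i j α + thetaExp i j β + thetaExp i' j' γ) := by
        simp only [pTerm, mTerm]; ring
    _ = _ := by
        rw [e, e2]; simp only [pTerm, mTerm]; ring

theorem ternary_dissection :
    pTheta X 3 2 ^ 2 * mTheta X 8 2
      = mTheta (X ^ 5) 6 4 * mTheta (X ^ 5) 3 2 ^ 2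
        + X ^ 2 * (mTheta (X ^ 5) 6 4 * mTheta (X ^ 5) 4 1 ^ 2)
        + X ^ 3 * (2 * (mTheta (X ^ 5) 8 2 * (mTheta (X ^ 5) 4 1 * mTheta (X ^ 5) 3 2)))
        - X ^ 4 * (mTheta (X ^ 5) 8 2 * mTheta (X ^ 5) 4 1 ^ 2) := by
  have hX : (X : ℤ⟦X⟧) ∣ X := dvd_rfl
  have hQ : (X : ℤ⟦X⟧) ∣ X ^ 5 := dvd_pow_self X (by norm_num)
  set Q : ℤ⟦X⟧ := X ^ 5 with hQdef
  have h := tsum_mul_tsum_mul_tsum_split (tame_pTerm hX (i := 3) (by norm_num) 2)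
    (tame_pTerm hX (i := 3) (by norm_num) 2) (tame_mTerm hX (i := 8) (by norm_num) 2) ternarySplit
    bijective_ternarySplit
    ![sgn 0 * X ^ 0, sgn (-1) * X ^ 5, sgn 0 * X ^ 6, sgn 1 * X ^ 11, sgn 0 * X ^ 4,
      sgn (-1) * X ^ 4, sgn 1 * X ^ 8, sgn 0 * X ^ 3, sgn (-1) * X ^ 2, sgn 0 * X ^ 2]
    (u := ![mTerm Q 6 4, mTerm Q 6 4, mTerm Q 10 0, mTerm Q 10 0, mTerm Q 2 8,
      mTerm Q 2 8, mTerm Q 8 2, mTerm Q 8 2, mTerm Q 4 6, mTerm Q 4 6])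
    (v := ![pTerm Q 6 4, pTerm Q 1 9, pTerm Q 4 6, pTerm Q 9 1, pTerm Q 8 2,
      pTerm Q 3 7, pTerm Q 10 0, pTerm Q 5 5, pTerm Q 2 8, pTerm Q 7 3])
    (w := ![pTerm Q 1 1, pTerm Q 2 0, pTerm Q 1 1, pTerm Q 2 0, pTerm Q 1 1,
      pTerm Q 2 0, pTerm Q 1 1, pTerm Q 2 0, pTerm Q 1 1, pTerm Q 2 0])
    (by simp [Fin.forall_fin_succ, tame_mTerm hQ]) (by simp [Fin.forall_fin_succ, tame_pTerm hQ])
    (by simp [Fin.forall_fin_succ, tame_pTerm hQ])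
    (by
      simp only [Fin.forall_fin_succ]
      refine ⟨?_, ?_, ?_, ?_, ?_, ?_, ?_, ?_, ?_, ?_, fun i => i.elim0⟩ <;>
        (intro x m n
         apply ternary_term_eq
         · simp [ternarySplit, ternaryShift]
         · simp only [ternarySplit, ternaryShift]; simp; ring))
  -- Counting from 0, classes 2 and 3 vanish by `z`. The pairs (0, 1), (8, 9), (6, 7), (4, 5) give
  -- the four terms in order: `i1` evaluates the first, `i2` the second and fourth, `i3` the third.
  have i1 := mTheta_three_two_sq_eq hQ
  have i2 := mTheta_four_one_sq_eq hQ
  have i3 := two_mul_mTheta_mul_mTheta_eq hQ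
  have z := mTheta_zero_right Q 10
  have e1 := pTheta_comm Q 1 9
  have e2 := pTheta_comm Q 3 7
  have e3 := pTheta_comm Q 2 8
  have e4 := mTheta_comm Q 2 8
  have e5 := mTheta_comm Q 4 6
  have hl : pTheta X 3 2 ^ 2 * mTheta X 8 2
      = pTheta X 3 2 * (pTheta X 3 2 * mTheta X 8 2) := by ring
  rw [hl, ← i1, ← i2, show 2 * (mTheta Q 8 2 * (mTheta Q 4 1 * mTheta Q 3 2))
    = mTheta Q 8 2 * (2 * (mTheta Q 4 1 * mTheta Q 3 2)) by ring, ← i3]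
  simp only [pTheta, mTheta] at z e1 e2 e3 e4 e5 ⊢
  rw [h]
  simp [Fin.sum_univ_succ, z, e1, e2, e3, e4, e5, sgn_zero, sgn_one, sgn_neg_one]
  rw [hQdef]
  ring

/-! ### Product forms and the Rogers–Ramanujan products. -/

theorem qPochhammer_section {q : ℤ⟦X⟧} (hq : X ∣ q) :
    qPochhammer q q = qPochhammer q (q ^ 5) * qPochhammer (q ^ 2) (q ^ 5)
      * qPochhammer (q ^ 3) (q ^ 5) * qPochhammer (q ^ 4) (q ^ 5)
      * qPochhammer (q ^ 5) (q ^ 5) := by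
  have hq5 : X ∣ q ^ 5 := hq.trans (dvd_pow_self q (by norm_num))
  have h : ∀ N, finPoch q q (N * 5) = finPoch q (q ^ 5) N * finPoch (q ^ 2) (q ^ 5) N
      * finPoch (q ^ 3) (q ^ 5) N * finPoch (q ^ 4) (q ^ 5) N * finPoch (q ^ 5) (q ^ 5) N := by
    intro N
    induction N with
    | zero => simp [finPoch]
    | succ N ih =>
      have e : (N + 1) * 5 = N * 5 + 1 + 1 + 1 + 1 + 1 := by ring
      rw [e]
      simp only [finPoch_succ, ih]
      ring
  have t1 := (tendsto_finPoch q hq).comp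
    (Filter.tendsto_id.atTop_mul_const' (show 0 < 5 by norm_num))
  have t2 := ((((tendsto_finPoch q hq5).mul (tendsto_finPoch (q ^ 2) hq5)).mul
    (tendsto_finPoch (q ^ 3) hq5)).mul (tendsto_finPoch (q ^ 4) hq5)).mul
    (tendsto_finPoch (q ^ 5) hq5)
  exact tendsto_nhds_unique (t1.congr h) t2

theorem qPochhammer_eq_one_sub_mul (a : ℤ⟦X⟧) {b : ℤ⟦X⟧} (hb : X ∣ b) :
    qPochhammer a b = (1 - a) * qPochhammer (a * b) b := by
  have e : (fun n : ℕ => 1 - a * b * b ^ n) = fun n => 1 - a * b ^ (n + 1) := by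
    funext n
    ring
  have h : Multipliable fun n : ℕ => 1 - a * b ^ (n + 1) :=
    e ▸ multipliable_qPochhammer (a * b) b (X_dvd_iff.mp hb)
  have h2 := tprod_eq_zero_mul' (f := fun n : ℕ => 1 - a * b ^ n) h
  rw [pow_zero, mul_one] at h2
  rw [qPochhammer, qPochhammer, h2, e]

/-- The series `1 / (X ^ i; X ^ k)_∞`. -/
noncomputable def recPoch (i k : ℕ) : ℤ⟦X⟧ := invOfUnit (qPochhammer (X ^ i) (X ^ k)) 1

theorem recPoch_mul {i k : ℕ} (hi : i ≠ 0) (hk : k ≠ 0) :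
    recPoch i k * qPochhammer (X ^ i) (X ^ k) = 1 :=
  invOfUnit_mul _ _
    (by simp [constantCoeff_qPochhammer (dvd_pow_self (X : ℤ⟦X⟧) hi) (dvd_pow_self X hk)])

/-- Power series in `X ^ 5` with nonnegative coefficients, as a multiplicative submonoid. -/
def nonnegFive : Submonoid ℤ⟦X⟧ where
  carrier := {f | ∀ n, 0 ≤ coeff n f ∧ (¬ 5 ∣ n → coeff n f = 0)}
  one_mem' n := by
    rw [coeff_one]
    split_ifs with h <;> simp [h]
  mul_mem' {f g} hf hg n := by
    rw [coeff_mul]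
    refine ⟨Finset.sum_nonneg fun p _ => mul_nonneg (hf _).1 (hg _).1, fun hn => ?_⟩
    refine Finset.sum_eq_zero fun p hp => ?_
    have hp := Finset.HasAntidiagonal.mem_antidiagonal.mp hp
    by_cases h1 : 5 ∣ p.1
    · rw [(hg p.2).2 (by omega), mul_zero]
    · rw [(hf p.1).2 h1, zero_mul]

theorem coeff_add_mul_pos {f g : ℤ⟦X⟧} (hf : f ∈ nonnegFive) (hg : g ∈ nonnegFive) {i j : ℕ}
    (hi : 0 < coeff i f) (hj : 0 < coeff j g) : 0 < coeff (i + j) (f * g) := by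
  rw [coeff_mul]
  exact Finset.sum_pos' (fun p _ => mul_nonneg (hf _).1 (hg _).1)
    ⟨(i, j), by simp, mul_pos hi hj⟩

/-- The geometric series `1 / (1 - X ^ k)`. -/
def geom (k : ℕ) : ℤ⟦X⟧ := mk fun n => if k ∣ n then 1 else 0

theorem geom_mul {k : ℕ} (hk : k ≠ 0) : geom k * (1 - X ^ k) = 1 := by
  ext n
  rw [mul_sub, mul_one, map_sub, coeff_mul_X_pow', geom, coeff_mk, coeff_one]
  by_cases h : k ≤ n
  · rw [if_pos h, coeff_mk, if_neg (show n ≠ 0 by omega)]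
    simp [Nat.dvd_sub_iff_left h]
  · rw [if_neg h]
    by_cases h0 : n = 0
    · simp [h0]
    · have : ¬ k ∣ n := fun hd => h (Nat.le_of_dvd (Nat.pos_of_ne_zero h0) hd)
      simp [h0, this]

theorem geom_mem {k : ℕ} (hk : 5 ∣ k) : geom k ∈ nonnegFive := by
  intro n
  rw [geom, coeff_mk]
  split_ifs with h
  · exact ⟨zero_le_one, fun hn => absurd (hk.trans h) hn⟩
  · exact ⟨le_rfl, fun _ => rfl⟩

/-- A finite product of geometric series inverts the truncated Pochhammer symbol and agrees with
`recPoch` up to any prescribed degree. -/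
theorem recPoch_mem {i k : ℕ} (hi : i ≠ 0) (hk : k ≠ 0) (hi5 : 5 ∣ i) (hk5 : 5 ∣ k) :
    recPoch i k ∈ nonnegFive := by
  have key : ∀ N, ∃ J ∈ nonnegFive, J * finPoch (X ^ i) (X ^ k) N = 1 := by
    intro N
    induction N with
    | zero => exact ⟨1, one_mem _, by simp [finPoch]⟩
    | succ N ih =>
      obtain ⟨J, hJ, h⟩ := ih
      refine ⟨J * geom (i + k * N), mul_mem hJ (geom_mem (hi5.add (hk5.mul_right N))), ?_⟩
      have h2 := geom_mul (k := i + k * N) (by omega)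
      rw [finPoch_succ, ← pow_mul, ← pow_add]
      linear_combination h * geom (i + k * N) * (1 - X ^ (i + k * N)) + h2
  intro n
  obtain ⟨J, hJ, h⟩ := key (n + 1)
  have h1 : X ^ (n + 1) ∣ recPoch i k - J := by
    obtain ⟨u, hu⟩ := X_pow_dvd_qPochhammer_sub (X ^ i) (dvd_pow_self (X : ℤ⟦X⟧) hk) (n + 1)
    refine ⟨-(recPoch i k * J * u), ?_⟩
    linear_combination J * recPoch_mul hi hk - recPoch i k * h - recPoch i k * J * hu
  have h2 := X_pow_dvd_iff.mp h1 n n.lt_succ_self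
  rw [map_sub, sub_eq_zero] at h2
  rw [h2]
  exact hJ n

/-- Splitting off the first factor leaves a geometric series in `X ^ i` times a nonnegative series
with constant term `1`. -/
theorem coeff_recPoch_pos {i k : ℕ} (hi : i ≠ 0) (hk : k ≠ 0) (hi5 : 5 ∣ i) (hk5 : 5 ∣ k)
    (m : ℕ) : 0 < coeff (i * m) (recPoch i k) := by
  have e : recPoch i k = geom i * recPoch (i + k) k := by
    have h1 := recPoch_mul hi hk
    have h2 := recPoch_mul (i := i + k) (by omega) hk
    have h3 := geom_mul hi
    rw [qPochhammer_eq_one_sub_mul _ (dvd_pow_self (X : ℤ⟦X⟧) hk), ← pow_add] at h1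
    linear_combination geom i * recPoch (i + k) k * h1 - recPoch i k * h2
      - recPoch i k * recPoch (i + k) k * qPochhammer (X ^ (i + k)) (X ^ k) * h3
  have h0 : coeff 0 (recPoch (i + k) k) = 1 := by
    rw [coeff_zero_eq_constantCoeff_apply, recPoch, constantCoeff_invOfUnit]
    simp
  rw [e, ← add_zero (i * m)]
  refine coeff_add_mul_pos (geom_mem hi5)
    (recPoch_mem (by omega) hk (hi5.add hk5) hk5) ?_ (by simp [h0])
  simp [geom]

/-- The series `1 / (q, q⁴; q⁵)_∞` at `q = X ^ 5`. -/
noncomputable def rrG : ℤ⟦X⟧ := recPoch 5 25 * recPoch 20 25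

/-- The series `1 / (q², q³; q⁵)_∞` at `q = X ^ 5`. -/
noncomputable def rrH : ℤ⟦X⟧ := recPoch 10 25 * recPoch 15 25

/-- The series `1 / (q, q⁴; q⁵)_∞` at `q = X ^ 10`. -/
noncomputable def rrG₂ : ℤ⟦X⟧ := recPoch 10 50 * recPoch 40 50

/-- The series `1 / (q², q³; q⁵)_∞` at `q = X ^ 10`. -/
noncomputable def rrH₂ : ℤ⟦X⟧ := recPoch 20 50 * recPoch 30 50

/-- The triple product gives three of the five residue classes of the full Pochhammer symbol; the
reciprocal of the other two is the Rogers–Ramanujan factor. -/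
theorem mTheta_eq_mul_recPoch :
    mTheta (X ^ 5 : ℤ⟦X⟧) 4 1 = qPochhammer (X ^ 5) (X ^ 5) * rrH ∧
    mTheta (X ^ 5 : ℤ⟦X⟧) 3 2 = qPochhammer (X ^ 5) (X ^ 5) * rrG ∧
    mTheta (X ^ 5 : ℤ⟦X⟧) 8 2 = qPochhammer (X ^ 10) (X ^ 10) * rrH₂ ∧
    mTheta (X ^ 5 : ℤ⟦X⟧) 6 4 = qPochhammer (X ^ 10) (X ^ 10) * rrG₂ := by
  have hQ : (X : ℤ⟦X⟧) ∣ X ^ 5 := dvd_pow_self X (by norm_num)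
  have s1 := qPochhammer_section (q := (X : ℤ⟦X⟧) ^ 5) hQ
  have s2 := qPochhammer_section (q := (X : ℤ⟦X⟧) ^ 10) (dvd_pow_self X (by norm_num))
  have t1 := mTheta_eq_qPochhammer hQ (i := 4) (j := 1) (by norm_num) (by norm_num)
  have t2 := mTheta_eq_qPochhammer hQ (i := 3) (j := 2) (by norm_num) (by norm_num)
  have t3 := mTheta_eq_qPochhammer hQ (i := 8) (j := 2) (by norm_num) (by norm_num)
  have t4 := mTheta_eq_qPochhammer hQ (i := 6) (j := 4) (by norm_num) (by norm_num)
  have r1 := recPoch_mul (i := 5) (k := 25) (by norm_num) (by norm_num)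
  have r2 := recPoch_mul (i := 10) (k := 25) (by norm_num) (by norm_num)
  have r3 := recPoch_mul (i := 15) (k := 25) (by norm_num) (by norm_num)
  have r4 := recPoch_mul (i := 20) (k := 25) (by norm_num) (by norm_num)
  have r5 := recPoch_mul (i := 10) (k := 50) (by norm_num) (by norm_num)
  have r6 := recPoch_mul (i := 20) (k := 50) (by norm_num) (by norm_num)
  have r7 := recPoch_mul (i := 30) (k := 50) (by norm_num) (by norm_num)
  have r8 := recPoch_mul (i := 40) (k := 50) (by norm_num) (by norm_num)
  simp only [← pow_mul, Nat.reduceMul, Nat.reduceAdd] at s1 s2 t1 t2 t3 t4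
  have inv_mul : ∀ {r r' p p' : ℤ⟦X⟧}, r * p = 1 → r' * p' = 1 → p * p' * (r * r') = 1 := by
    intro r r' p p' h h'
    linear_combination r' * p' * h + h'
  refine ⟨?_, ?_, ?_, ?_⟩
  · rw [t1, s1, rrH]
    linear_combination -(qPochhammer (X ^ 5) (X ^ 25) * qPochhammer (X ^ 20) (X ^ 25)
      * qPochhammer (X ^ 25) (X ^ 25)) * inv_mul r2 r3
  · rw [t2, s1, rrG]
    linear_combination -(qPochhammer (X ^ 10) (X ^ 25) * qPochhammer (X ^ 15) (X ^ 25)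
      * qPochhammer (X ^ 25) (X ^ 25)) * inv_mul r1 r4
  · rw [t3, s2, rrH₂]
    linear_combination -(qPochhammer (X ^ 10) (X ^ 50) * qPochhammer (X ^ 40) (X ^ 50)
      * qPochhammer (X ^ 50) (X ^ 50)) * inv_mul r6 r7
  · rw [t4, s2, rrG₂]
    linear_combination -(qPochhammer (X ^ 20) (X ^ 50) * qPochhammer (X ^ 30) (X ^ 50)
      * qPochhammer (X ^ 50) (X ^ 50)) * inv_mul r5 r8

theorem h₁Series_mul : h₁Series * (qPochhammer (X ^ 5) (X ^ 5) ^ 2 * qPochhammer (X ^ 10) (X ^ 10))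
    = pTheta X 3 2 ^ 2 * mTheta X 8 2 := by
  rw [pTheta_eq_qPochhammer dvd_rfl (by norm_num) (by norm_num),
    mTheta_eq_qPochhammer dvd_rfl (by norm_num) (by norm_num), h₁Series, qPochhammer₂,
    qPochhammer₂]
  ring

/-- The `5`-dissection of the generating function of `h₁`. -/
theorem h₁Series_eq : h₁Series = rrG ^ 2 * rrG₂ + X ^ 2 * (rrH ^ 2 * rrG₂)
    + X ^ 3 * (2 * (rrG * rrH * rrH₂)) - X ^ 4 * (rrH ^ 2 * rrH₂) := by
  have h5 := qPochhammer_ne_zero (dvd_pow_self (X : ℤ⟦X⟧) (show 5 ≠ 0 by norm_num))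
    (dvd_pow_self (X : ℤ⟦X⟧) (show 5 ≠ 0 by norm_num))
  have h10 := qPochhammer_ne_zero (dvd_pow_self (X : ℤ⟦X⟧) (show 10 ≠ 0 by norm_num))
    (dvd_pow_self (X : ℤ⟦X⟧) (show 10 ≠ 0 by norm_num))
  refine mul_right_cancel₀ (mul_ne_zero (pow_ne_zero 2 h5) h10) ?_
  obtain ⟨e1, e2, e3, e4⟩ := mTheta_eq_mul_recPoch
  rw [h₁Series_mul, ternary_dissection, e1, e2, e3, e4]
  ring

/-! ### Signs of the coefficients. -/

theorem coeff_X_pow_mul_nonnegFive {f : ℤ⟦X⟧} (hf : f ∈ nonnegFive) {r s : ℕ} (hr : r < 5)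
    (hs : s < 5) (n : ℕ) :
    coeff (5 * n + r) (X ^ s * f) = if s = r then coeff (5 * n) f else 0 := by
  rw [coeff_X_pow_mul']
  rcases eq_or_ne s r with rfl | h
  · simp
  · rw [if_neg h]
    split_ifs
    · exact (hf _).2 (by omega)
    · rfl

theorem coeff_zero_recPoch_pos {i k : ℕ} (hi : i ≠ 0) (hk : k ≠ 0) (hi5 : 5 ∣ i) (hk5 : 5 ∣ k) :
    0 < coeff 0 (recPoch i k) := by
  simpa only [mul_zero] using coeff_recPoch_pos hi hk hi5 hk5 0

theorem rrG_mem : rrG ∈ nonnegFive := by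
  apply mul_mem <;> apply recPoch_mem <;> norm_num

theorem rrH_mem : rrH ∈ nonnegFive := by
  apply mul_mem <;> apply recPoch_mem <;> norm_num

theorem rrG₂_mem : rrG₂ ∈ nonnegFive := by
  apply mul_mem <;> apply recPoch_mem <;> norm_num

theorem rrH₂_mem : rrH₂ ∈ nonnegFive := by
  apply mul_mem <;> apply recPoch_mem <;> norm_num

theorem coeff_rrG_pos (n : ℕ) : 0 < coeff (5 * n) rrG :=
  coeff_add_mul_pos (i := 5 * n) (j := 0)
    (recPoch_mem (by norm_num) (by norm_num) (by norm_num) (by norm_num))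
    (recPoch_mem (by norm_num) (by norm_num) (by norm_num) (by norm_num))
    (coeff_recPoch_pos (by norm_num) (by norm_num) (by norm_num) (by norm_num) n)
    (coeff_zero_recPoch_pos (by norm_num) (by norm_num) (by norm_num) (by norm_num))

theorem coeff_rrH_pos {n : ℕ} (hn : n ≠ 1) : 0 < coeff (5 * n) rrH := by
  obtain ⟨i, j, h⟩ : ∃ i j, 5 * n = 10 * i + 15 * j := by
    rcases Nat.even_or_odd' n with ⟨k, h | h⟩
    · exact ⟨k, 0, by omega⟩
    -- For odd `n = 2k + 1`, `n ≠ 1` gives `k ≥ 1`, so `n = 2(k - 1) + 3` without truncated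
    -- subtraction.
    · exact ⟨k - 1, 1, by omega⟩
  rw [h]
  apply coeff_add_mul_pos <;> first | apply recPoch_mem | apply coeff_recPoch_pos
  all_goals norm_num

theorem coeff_mul_pos_of_coeff_zero_pos {f g : ℤ⟦X⟧} (hf : f ∈ nonnegFive) (hg : g ∈ nonnegFive)
    {n : ℕ} (hn : 0 < coeff n f) (h0 : 0 < coeff 0 g) : 0 < coeff n (f * g) :=
  coeff_add_mul_pos (j := 0) hf hg hn h0

theorem coeff_zero_rrG_pos : 0 < coeff 0 rrG := by
  simpa only [mul_zero] using coeff_rrG_pos 0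

theorem coeff_zero_rrH_pos : 0 < coeff 0 rrH := by
  simpa only [mul_zero] using coeff_rrH_pos zero_ne_one

theorem coeff_zero_rrG₂_pos : 0 < coeff 0 rrG₂ :=
  coeff_mul_pos_of_coeff_zero_pos
    (recPoch_mem (by norm_num) (by norm_num) (by norm_num) (by norm_num))
    (recPoch_mem (by norm_num) (by norm_num) (by norm_num) (by norm_num))
    (coeff_zero_recPoch_pos (by norm_num) (by norm_num) (by norm_num) (by norm_num))
    (coeff_zero_recPoch_pos (by norm_num) (by norm_num) (by norm_num) (by norm_num))

theorem coeff_zero_rrH₂_pos : 0 < coeff 0 rrH₂ :=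
  coeff_mul_pos_of_coeff_zero_pos
    (recPoch_mem (by norm_num) (by norm_num) (by norm_num) (by norm_num))
    (recPoch_mem (by norm_num) (by norm_num) (by norm_num) (by norm_num))
    (coeff_zero_recPoch_pos (by norm_num) (by norm_num) (by norm_num) (by norm_num))
    (coeff_zero_recPoch_pos (by norm_num) (by norm_num) (by norm_num) (by norm_num))

theorem h₁_eq {n r : ℕ} (hr : r < 5) : h₁ (5 * n + r)
    = (if 0 = r then coeff (5 * n) (rrG ^ 2 * rrG₂) else 0)
      + (if 2 = r then coeff (5 * n) (rrH ^ 2 * rrG₂) else 0)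
      + (if 3 = r then 2 * coeff (5 * n) (rrG * rrH * rrH₂) else 0)
      - (if 4 = r then coeff (5 * n) (rrH ^ 2 * rrH₂) else 0) := by
  have m0 := mul_mem (pow_mem rrG_mem 2) rrG₂_mem
  have m2 := mul_mem (pow_mem rrH_mem 2) rrG₂_mem
  have m3 := mul_mem (mul_mem rrG_mem rrH_mem) rrH₂_mem
  have m4 := mul_mem (pow_mem rrH_mem 2) rrH₂_mem
  have e : h₁Series = X ^ 0 * (rrG ^ 2 * rrG₂) + X ^ 2 * (rrH ^ 2 * rrG₂)
    + (X ^ 3 * (rrG * rrH * rrH₂) + X ^ 3 * (rrG * rrH * rrH₂)) - X ^ 4 * (rrH ^ 2 * rrH₂) := by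
    rw [h₁Series_eq]; ring
  rw [h₁, e]
  simp only [map_add, map_sub, coeff_X_pow_mul_nonnegFive m0 hr (show 0 < 5 by norm_num),
    coeff_X_pow_mul_nonnegFive m2 hr (show 2 < 5 by norm_num),
    coeff_X_pow_mul_nonnegFive m3 hr (show 3 < 5 by norm_num),
    coeff_X_pow_mul_nonnegFive m4 hr (show 4 < 5 by norm_num)]
  split_ifs <;> ring

theorem h₁_five_mul_pos (n : ℕ) : 0 < h₁ (5 * n) := by
  have h := h₁_eq (n := n) (show 0 < 5 by norm_num)
  rw [add_zero] at h
  simp only [h, if_true, OfNat.ofNat_ne_zero, if_false, add_zero, sub_zero, sq]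
  exact coeff_mul_pos_of_coeff_zero_pos (mul_mem rrG_mem rrG_mem) rrG₂_mem
    (coeff_mul_pos_of_coeff_zero_pos rrG_mem rrG_mem (coeff_rrG_pos n) coeff_zero_rrG_pos)
    coeff_zero_rrG₂_pos

theorem h₁_five_mul_add_one (n : ℕ) : h₁ (5 * n + 1) = 0 := by
  have h := h₁_eq (n := n) (show 1 < 5 by norm_num)
  simpa using h

theorem h₁_five_mul_add_two_pos {n : ℕ} (hn : n ≠ 1) : 0 < h₁ (5 * n + 2) := by
  have h := h₁_eq (n := n) (show 2 < 5 by norm_num)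
  simp only [Nat.reduceEqDiff, OfNat.zero_ne_ofNat, if_true, if_false, zero_add, add_zero, sub_zero,
    sq] at h
  rw [h]
  exact coeff_mul_pos_of_coeff_zero_pos (mul_mem rrH_mem rrH_mem) rrG₂_mem
    (coeff_mul_pos_of_coeff_zero_pos rrH_mem rrH_mem (coeff_rrH_pos hn)
      coeff_zero_rrH_pos) coeff_zero_rrG₂_pos

theorem h₁_five_mul_add_three_pos (n : ℕ) : 0 < h₁ (5 * n + 3) := by
  have h := h₁_eq (n := n) (show 3 < 5 by norm_num)
  simp only [Nat.reduceEqDiff, OfNat.zero_ne_ofNat, if_true, if_false, zero_add, add_zero, sub_zero] at h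
  rw [h]
  exact mul_pos two_pos (coeff_mul_pos_of_coeff_zero_pos (mul_mem rrG_mem rrH_mem) rrH₂_mem
    (coeff_mul_pos_of_coeff_zero_pos rrG_mem rrH_mem (coeff_rrG_pos n)
      coeff_zero_rrH_pos) coeff_zero_rrH₂_pos)

theorem h₁_five_mul_add_four_neg {n : ℕ} (hn : n ≠ 1) : h₁ (5 * n + 4) < 0 := by
  have h := h₁_eq (n := n) (show 4 < 5 by norm_num)
  simp only [Nat.reduceEqDiff, OfNat.zero_ne_ofNat, if_true, if_false, add_zero, zero_sub,
    sq] at h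
  rw [h]
  exact neg_neg_of_pos (coeff_mul_pos_of_coeff_zero_pos (mul_mem rrH_mem rrH_mem) rrH₂_mem
    (coeff_mul_pos_of_coeff_zero_pos rrH_mem rrH_mem (coeff_rrH_pos hn)
      coeff_zero_rrH_pos) coeff_zero_rrH₂_pos)

theorem mainTheorem6 :
    (∀ n : ℕ,
      0 < h₁ (5 * n) ∧
      (n ≠ 1 → 0 < h₁ (5 * n + 2)) ∧
      0 < h₁ (5 * n + 3) ∧
      (n ≠ 1 → h₁ (5 * n + 4) < 0)) ∧
    (∃ N : ℕ, ∀ n : ℕ, N ≤ n → SignType.sign (h₁ (n + 5)) = SignType.sign (h₁ n)) := by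
  -- The bound 10 lies past the exceptional indices `7` and `9`.
  refine ⟨fun n => ⟨h₁_five_mul_pos n, h₁_five_mul_add_two_pos, h₁_five_mul_add_three_pos n,
    h₁_five_mul_add_four_neg⟩, 10, fun n hn => ?_⟩
  obtain ⟨k, h | h | h | h | h⟩ : ∃ k, n = 5 * k ∨ n = 5 * k + 1 ∨ n = 5 * k + 2 ∨
      n = 5 * k + 3 ∨ n = 5 * k + 4 := ⟨n / 5, by omega⟩
  · rw [show n + 5 = 5 * (k + 1) by omega, h, sign_pos (h₁_five_mul_pos _),
      sign_pos (h₁_five_mul_pos _)]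
  · rw [show n + 5 = 5 * (k + 1) + 1 by omega, h, h₁_five_mul_add_one, h₁_five_mul_add_one]
  · rw [show n + 5 = 5 * (k + 1) + 2 by omega, h,
      sign_pos (h₁_five_mul_add_two_pos (by omega)), sign_pos (h₁_five_mul_add_two_pos (by omega))]
  · rw [show n + 5 = 5 * (k + 1) + 3 by omega, h, sign_pos (h₁_five_mul_add_three_pos _),
      sign_pos (h₁_five_mul_add_three_pos _)]
  · rw [show n + 5 = 5 * (k + 1) + 4 by omega, h,
      sign_neg (h₁_five_mul_add_four_neg (by omega)),
      sign_neg (h₁_five_mul_add_four_neg (by omega))]
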